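/- For a connected graph $G$ on a finite vertex set, let $d_G(u,v)$ be the distance and $e_G(u)=\max_v d_G(u,v)$ the eccentricity. The eccentricity matrix $\mathcal{E}(G)$ is the real symmetric matrix indexed by the vertices with $\mathcal{E}(G)_{uv}=d_G(u,v)$ if $d_G(u,v)=\min\{e_G(u),e_G(v)\}$, and $\mathcal{E}(G)_{uv}=0$ otherwise. For $G$ with $n$ vertices, let $\xi_n(G)$ denote the least eigenvalue of $\mathcal{E}(G)$. For $n\ge 4$, let $T_{n,3}^{0,n-4}$ be the tree on $n$ vertices obtained from the path $v_0v_1v_2v_3$ by attaching $n-4$ pendant vertices to $v_2$. Theorem. Let $n\ge 4$ and let $T$ be a tree on $n$ vertices whose complement $T^c$ is connected (equivalently, $T$ is not a star). Then $$\xi_n(T^c)\ \ge\ \xi_n\big((T_{n,3}^{0,n-4})^c\big),$$ with equality if and only if $T\cong T_{n,3}^{0,n-4}$. -/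

import Mathlib

namespace EccComplTree

/-- The eccentricity matrix of a (connected) graph: the `(u, v)` entry is `d(u, v)` if
`d(u, v) = min (e(u)) (e(v))`, and `0` otherwise. -/
noncomputable def eccMatrix {V : Type*} (G : SimpleGraph V) : Matrix V V ℝ :=
  open Classical in
  Matrix.of fun u v =>
    if (G.dist u v : ℕ∞) = min (G.eccent u) (G.eccent v) then (G.dist u v : ℝ) else 0

/-- The set of eigenvalues of the eccentricity matrix. -/
def eccEigenvalues {V : Type*} [Fintype V] (G : SimpleGraph V) : Set ℝ :=
  {μ : ℝ | Module.End.HasEigenvalue (Matrix.mulVecLin (eccMatrix G)) μ}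

/-- The least eigenvalue of the eccentricity matrix
(a genuine minimum, see `isLeast_leastEccEigenvalue`). -/
noncomputable def leastEccEigenvalue {V : Type*} [Fintype V] (G : SimpleGraph V) : ℝ :=
  sInf (eccEigenvalues G)

theorem eccMatrix_isHermitian {V : Type*} (G : SimpleGraph V) :
    (eccMatrix G).IsHermitian := by
  ext u v
  simp [eccMatrix, Matrix.conjTranspose_apply, SimpleGraph.dist_comm (u := v) (v := u),
    min_comm (G.eccent v) (G.eccent u)]

theorem isLeast_leastEccEigenvalue {V : Type*} [Fintype V] [Nonempty V] (G : SimpleGraph V) :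
    IsLeast (eccEigenvalues G) (leastEccEigenvalue G) := by
  classical
  have hfin : (eccEigenvalues G).Finite :=
    Module.End.finite_hasEigenvalue (Matrix.mulVecLin (eccMatrix G))
  have hne : (eccEigenvalues G).Nonempty := by
    obtain ⟨i⟩ := ‹Nonempty V›
    refine ⟨(eccMatrix_isHermitian G).eigenvalues i, ?_⟩
    refine Module.End.hasEigenvalue_of_hasEigenvector
      (x := WithLp.ofLp ((eccMatrix_isHermitian G).eigenvectorBasis i))
      ⟨Module.End.mem_eigenspace_iff.mpr ?_, ?_⟩
    · exact (eccMatrix_isHermitian G).mulVec_eigenvectorBasis i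
    · intro h
      exact (eccMatrix_isHermitian G).eigenvectorBasis.toBasis.ne_zero i
        (by ext j; simpa using congrFun h j)
  exact ⟨hne.csInf_mem hfin, fun x hx => csInf_le hfin.bddBelow hx⟩

/-- The tree obtained from the path `v₀ v₁ v₂ v₃` (the vertices `Sum.inl i`, `i : Fin 4`) by
attaching `a` pendant vertices to `v₁` and `b` pendant vertices to `v₂`; its order is
`n = a + b + 4`, and it is the tree denoted `T_{n,3}^{a,b}`. -/
def doubleStar (a b : ℕ) : SimpleGraph (Fin 4 ⊕ (Fin a ⊕ Fin b)) :=
  SimpleGraph.fromRel fun x y =>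
    match x, y with
    | Sum.inl i, Sum.inl j => j.val = i.val + 1
    | Sum.inl i, Sum.inr (Sum.inl _) => i = 1
    | Sum.inl i, Sum.inr (Sum.inr _) => i = 2
    | Sum.inr _, _ => False

end EccComplTree

/-! Non-neighbours in `T` are at distance at most 1 in `Tᶜ`, where every eccentricity is at least 2,
so the matrix is supported on the edges of `T`. Call an edge dominating if every vertex is adjacent
to one of its ends.

Without a dominating edge the matrix is twice the adjacency matrix of `T`, and bipartiteness gives
`μ² ≤ 4(n - 1)` (`sq_le_of_mem_eccEigenvalues_compl`).

With one, `T` is a double star with `p, q ≥ 1` leaves at its centres and `p + q + 2 = n`. The entry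
between the centres is 3, and a nonzero `μ` is an eigenvalue iff `(μ² - 4p)(μ² - 4q) = 9μ²`
(`IsDoubleStar.mem_eccEigenvalues_compl`), that is, `s = μ²` solves `s² - (4n + 1)s + 16pq = 0`. The
larger root grows as `pq` decreases, and `pq ≥ n - 3` with equality iff `p = 1` or `q = 1`: the
broom. Its root exceeds `4(n - 1)`, so it beats the first case too. The equation is even in `μ`, so
the least eigenvalue is minus the square root. -/

namespace EccComplTree

open SimpleGraph

variable {V : Type*} {T : SimpleGraph V} {u v w x y z : V}

/-! ### Acyclic graphs with a dominating edge. -/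

/-- `T` is a double star with centres `u` and `v`: the centres are adjacent, every other vertex is
adjacent to exactly one of them, and there are no further edges. -/
structure IsDoubleStar (T : SimpleGraph V) (u v : V) : Prop where
  adj : T.Adj u v
  dominating : ∀ x, x ≠ u → x ≠ v → T.Adj u x ∨ T.Adj v x
  not_adj_both : ∀ x, T.Adj u x → ¬ T.Adj v x
  edge : ∀ x y, T.Adj x y → x = u ∨ x = v ∨ y = u ∨ y = v

theorem IsDoubleStar.symm (h : IsDoubleStar T u v) : IsDoubleStar T v u where
  adj := h.adj.symm
  dominating x hv hu := (h.dominating x hu hv).symm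
  not_adj_both x hv hu := h.not_adj_both x hu hv
  edge x y hxy := by have := h.edge x y hxy; tauto

theorem _root_.SimpleGraph.IsAcyclic.not_adj_of_adj_adj (hT : T.IsAcyclic) (h₁ : T.Adj x y)
    (h₂ : T.Adj y z) : ¬ T.Adj x z := by
  intro h
  have := (hT.subsingleton_path _ _).elim ⟨.cons h .nil, by simp [h.ne]⟩
    ⟨.cons h₁ (.cons h₂ .nil), by simp [h₁.ne, h₂.ne, h.ne]⟩
  simpa using congrArg (fun p : T.Path x z => p.1.length) this

theorem _root_.SimpleGraph.IsAcyclic.not_adj_of_adj_adj_adj (hT : T.IsAcyclic)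
    (h₁ : T.Adj x y) (h₂ : T.Adj y z) (h₃ : T.Adj z w) (hxz : x ≠ z) (hyw : y ≠ w) :
    ¬ T.Adj x w := by
  intro h
  have := (hT.subsingleton_path _ _).elim ⟨.cons h .nil, by simp [h.ne]⟩
    ⟨.cons h₁ (.cons h₂ (.cons h₃ .nil)), by simp [h₁.ne, h₂.ne, h₃.ne, h.ne, hxz, hyw]⟩
  simpa using congrArg (fun p : T.Path x w => p.1.length) this

/-- An acyclic graph with a dominating edge is a double star. -/
theorem isDoubleStar_of_isAcyclic (hT : T.IsAcyclic) (huv : T.Adj u v)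
    (hdom : ∀ x, x ≠ u → x ≠ v → T.Adj u x ∨ T.Adj v x) : IsDoubleStar T u v where
  adj := huv
  dominating := hdom
  not_adj_both x hu hv := hT.not_adj_of_adj_adj huv hv hu
  edge x y hxy := by
    by_contra! hne
    obtain ⟨hxu, hxv, hyu, hyv⟩ := hne
    -- An edge avoiding both centres would close a triangle or a 4-cycle.
    rcases hdom x hxu hxv with hx | hx <;> rcases hdom y hyu hyv with hy | hy
    · exact hT.not_adj_of_adj_adj hx hxy hy
    · exact hT.not_adj_of_adj_adj_adj hx hxy hy.symm hyu.symm hxv huv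
    · exact hT.not_adj_of_adj_adj_adj hx hxy hy.symm hyv.symm hxu huv.symm
    · exact hT.not_adj_of_adj_adj hx hxy hy

/-! ### Distances and eccentricities in the complement. -/

section Distance

theorem dist_compl_le_one (h : ¬ T.Adj x y) : Tᶜ.dist x y ≤ 1 := by
  by_cases hxy : x = y
  · simp [hxy]
  · exact (dist_eq_one_iff_adj.mpr ((compl_adj ..).mpr ⟨hxy, h⟩)).le

theorem two_le_dist_compl (hc : Tᶜ.Connected) (h : T.Adj x y) : 2 ≤ Tᶜ.dist x y :=
  hc.one_lt_dist_of_ne_of_not_adj h.ne fun h' => ((compl_adj ..).mp h').2 h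

theorem dist_compl_le_two (hc : Tᶜ.Connected) (hx : ¬ T.Adj x z) (hy : ¬ T.Adj z y) :
    Tᶜ.dist x y ≤ 2 := by
  have h₁ := hc.dist_triangle (u := x) (v := z) (w := y)
  have h₂ := dist_compl_le_one hx
  have h₃ := dist_compl_le_one hy
  omega

theorem coe_dist_le_eccent {G : SimpleGraph V} (hc : G.Connected) (x y : V) :
    (G.dist x y : ℕ∞) ≤ G.eccent x :=
  (hc x y).coe_dist_eq_edist ▸ edist_le_eccent

theorem eccent_le_coe {G : SimpleGraph V} (hc : G.Connected) {k : ℕ} (h : ∀ y, G.dist x y ≤ k) :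
    G.eccent x ≤ k :=
  (eccent_le_iff ..).mpr fun y => (hc x y).coe_dist_eq_edist ▸ by exact_mod_cast h y

theorem two_le_eccent_compl (hc : Tᶜ.Connected) (hn : ∀ x, ∃ y, T.Adj x y) (x : V) :
    2 ≤ Tᶜ.eccent x := by
  obtain ⟨y, hy⟩ := hn x
  refine le_trans ?_ (coe_dist_le_eccent hc x y)
  exact_mod_cast two_le_dist_compl hc hy

theorem eccMatrix_compl_of_not_adj (hc : Tᶜ.Connected) (hn : ∀ x, ∃ y, T.Adj x y)
    (h : ¬ T.Adj x y) : eccMatrix Tᶜ x y = 0 := by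
  have h₁ : (Tᶜ.dist x y : ℕ∞) ≤ 1 := by exact_mod_cast dist_compl_le_one h
  have h₂ := le_min (two_le_eccent_compl hc hn x) (two_le_eccent_compl hc hn y)
  have h₃ : (Tᶜ.dist x y : ℕ∞) ≠ min (Tᶜ.eccent x) (Tᶜ.eccent y) := fun h =>
    absurd ((h₂.trans h.ge).trans h₁) (by decide)
  simp [eccMatrix, h₃]

/-- If `y` is farthest from `x`, then `d(x, y) = e(x) ≤ e(y)`, so the minimum is attained at `x`. -/
theorem eccMatrix_eq_dist {G : SimpleGraph V} (hc : G.Connected)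
    (h : ∀ z, G.dist x z ≤ G.dist x y) : eccMatrix G x y = G.dist x y := by
  have h₁ := le_antisymm (eccent_le_coe hc h) (coe_dist_le_eccent hc x y)
  have h₂ := coe_dist_le_eccent hc y x
  rw [SimpleGraph.dist_comm] at h₂
  simp [eccMatrix, h₁, h₂]

theorem eccMatrix_comm (G : SimpleGraph V) (x y : V) : eccMatrix G x y = eccMatrix G y x := by
  simpa using (eccMatrix_isHermitian G).apply y x

/-- `hx` says that no edge at `x` is dominating, which forces `e(x) = 2` in the complement. -/
theorem eccMatrix_compl_eq_two (hc : Tᶜ.Connected) (h : T.Adj x y)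
    (hx : ∀ w, T.Adj x w → ∃ z, ¬ T.Adj x z ∧ ¬ T.Adj z w) : eccMatrix Tᶜ x y = 2 := by
  have key : ∀ w, Tᶜ.dist x w ≤ 2 := fun w => by
    by_cases hw : T.Adj x w
    · obtain ⟨z, hz⟩ := hx w hw
      exact dist_compl_le_two hc hz.1 hz.2
    · exact (dist_compl_le_one hw).trans one_le_two
  have h₂ : Tᶜ.dist x y = 2 := le_antisymm (key y) (two_le_dist_compl hc h)
  rw [eccMatrix_eq_dist hc (by simpa [h₂] using key), h₂]
  norm_num

end Distance

/-! ### Matrix entries for a double star. -/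

namespace IsDoubleStar

variable {p q : V}

theorem exists_adj (h : IsDoubleStar T u v) (x : V) : ∃ y, T.Adj x y := by
  by_cases hu : x = u
  · exact ⟨v, hu ▸ h.adj⟩
  by_cases hv : x = v
  · exact ⟨u, hv ▸ h.adj.symm⟩
  rcases h.dominating x hu hv with h | h
  exacts [⟨u, h.symm⟩, ⟨v, h.symm⟩]

theorem eq_of_adj_leaf (h : IsDoubleStar T u v) (hp : T.Adj u p) (hpv : p ≠ v) (hx : T.Adj p x) :
    x = u := by
  rcases h.edge p x hx with rfl | rfl | rfl | rfl
  · exact absurd hp T.irrefl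
  · exact absurd rfl hpv
  · rfl
  · exact absurd hx.symm (h.not_adj_both _ hp)

/-- The complement contains the path `v p q u`, and every other vertex is joined in it to `p` or to
`v`. -/
theorem compl_connected (h : IsDoubleStar T u v) (hp : T.Adj u p) (hpv : p ≠ v)
    (hq : T.Adj v q) (hqu : q ≠ u) : Tᶜ.Connected := by
  have step : ∀ {x y}, ¬ T.Adj x y → Tᶜ.Reachable x y := fun {x y} hxy => by
    by_cases e : x = y
    · exact e ▸ Reachable.refl _
    · exact ((compl_adj ..).mpr ⟨e, hxy⟩ : Tᶜ.Adj x y).reachable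
  have hvp : Tᶜ.Reachable v p := step (h.not_adj_both p hp)
  have hqp : Tᶜ.Reachable q p := step fun e => hqu (h.eq_of_adj_leaf hp hpv e.symm)
  have huq : Tᶜ.Reachable u q := step fun e => h.not_adj_both q e hq
  have : ∀ x, Tᶜ.Reachable x p := fun x => by
    by_cases hxu : x = u
    · exact hxu ▸ huq.trans hqp
    by_cases hx : T.Adj v x
    · exact step fun e => hxu (h.eq_of_adj_leaf hp hpv e.symm)
    · exact (step fun e => hx e.symm).trans hvp
  exact (connected_iff _).mpr ⟨fun x y => (this x).trans (this y).symm, ⟨u⟩⟩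

/-- The path `u q p v` bounds the distance by 3; distance 2 would need a vertex adjacent in `T` to
neither centre. -/
theorem eccMatrix_center (h : IsDoubleStar T u v) (hc : Tᶜ.Connected) (hp : T.Adj u p)
    (hpv : p ≠ v) (hq : T.Adj v q) (hqu : q ≠ u) : eccMatrix Tᶜ u v = 3 := by
  have huq : ¬ T.Adj u q := fun e => h.not_adj_both q e hq
  have hqp : ¬ T.Adj q p := fun e => hqu (h.eq_of_adj_leaf hp hpv e.symm)
  have hpv' : ¬ T.Adj p v := fun e => h.not_adj_both p hp e.symm
  have h₁ : Tᶜ.dist u v ≤ 3 := by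
    have h₁ := hc.dist_triangle (u := u) (v := q) (w := v)
    have h₂ := dist_compl_le_two hc hqp hpv'
    have h₃ := dist_compl_le_one huq
    omega
  have h₂ : 2 ≤ Tᶜ.dist u v := two_le_dist_compl hc h.adj
  have h₃ : Tᶜ.dist u v ≠ 2 := fun e => by
    have e' := (hc u v).coe_dist_eq_edist
    rw [e] at e'
    obtain ⟨-, -, z, hz⟩ := edist_eq_two_iff.mp e'.symm
    simp only [mem_commonNeighbors, compl_adj] at hz
    rcases h.dominating z hz.1.1.symm hz.2.1.symm with e | e
    exacts [hz.1.2 e, hz.2.2 e]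
  have h₄ : Tᶜ.dist u v = 3 := by omega
  rw [eccMatrix_eq_dist hc, h₄]
  · norm_num
  intro z
  rw [h₄]
  by_cases hz : T.Adj u z
  · by_cases hzv : z = v
    · exact hzv ▸ h₁
    · exact (dist_compl_le_two hc huq fun e =>
        hqu (h.eq_of_adj_leaf hz hzv e.symm)).trans (by norm_num)
  · exact (dist_compl_le_one hz).trans (by norm_num)

theorem eccMatrix_leaf (h : IsDoubleStar T u v) (hc : Tᶜ.Connected) (hp : T.Adj u p)
    (hpv : p ≠ v) (hq : T.Adj v q) (hqu : q ≠ u) : eccMatrix Tᶜ p u = 2 :=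
  eccMatrix_compl_eq_two hc hp.symm fun _ hw => ⟨q,
    fun e => hqu (h.eq_of_adj_leaf hp hpv e),
    fun e => h.not_adj_both q ((h.eq_of_adj_leaf hp hpv hw) ▸ e.symm) hq⟩

end IsDoubleStar

/-! ### Eigenvalues in the two cases. -/

section Spectrum

variable [Fintype V]

theorem mem_eccEigenvalues_iff {G : SimpleGraph V} {μ : ℝ} :
    μ ∈ eccEigenvalues G ↔ ∃ f : V → ℝ, f ≠ 0 ∧ ∀ x, ∑ y, eccMatrix G x y * f y = μ * f x := by
  constructor
  · intro h
    obtain ⟨f, hf⟩ := Module.End.HasEigenvalue.exists_hasEigenvector h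
    exact ⟨f, hf.2, fun x => congrFun hf.apply_eq_smul x⟩
  · rintro ⟨f, hf, h⟩
    exact Module.End.hasEigenvalue_of_hasEigenvector
      ⟨Module.End.mem_eigenspace_iff.mpr (funext h), hf⟩

open Classical in
/-- The neighbours of `u` other than `v`. -/
noncomputable def leaves (T : SimpleGraph V) (u v : V) : Finset V :=
  {x | T.Adj u x ∧ x ≠ v}

@[simp]
theorem mem_leaves : x ∈ leaves T u v ↔ T.Adj u x ∧ x ≠ v := by simp [leaves]

namespace IsDoubleStar

theorem card_leaves_add (h : IsDoubleStar T u v) :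
    (leaves T u v).card + (leaves T v u).card + 2 = Fintype.card V := by
  classical
  have h₁ : Disjoint (leaves T u v) (leaves T v u) :=
    Finset.disjoint_left.mpr fun x hx hx' =>
      h.not_adj_both x (mem_leaves.mp hx).1 (mem_leaves.mp hx').1
  have h₂ : Disjoint (leaves T u v ∪ leaves T v u) {u, v} :=
    Finset.disjoint_left.mpr fun x hx hx' => by
      simp only [Finset.mem_union, mem_leaves, Finset.mem_insert, Finset.mem_singleton] at hx hx'
      rcases hx' with rfl | rfl <;> simp at hx
  have h₃ : (leaves T u v ∪ leaves T v u) ∪ {u, v} = Finset.univ :=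
    Finset.eq_univ_of_forall fun x => by
      simp only [Finset.mem_union, mem_leaves, Finset.mem_insert, Finset.mem_singleton]
      have := h.dominating x
      tauto
  rw [← Finset.card_univ, ← h₃, Finset.card_union_of_disjoint h₂, Finset.card_union_of_disjoint h₁,
    Finset.card_pair h.adj.ne]

theorem sum_eccMatrix_center (h : IsDoubleStar T u v) (hu : (leaves T u v).Nonempty)
    (hv : (leaves T v u).Nonempty) (f : V → ℝ) :
    ∑ y, eccMatrix Tᶜ u y * f y = 3 * f v + 2 * ∑ y ∈ leaves T u v, f y := by
  classical
  obtain ⟨p, hp⟩ := hu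
  obtain ⟨q, hq⟩ := hv
  rw [mem_leaves] at hp hq
  have hc := h.compl_connected hp.1 hp.2 hq.1 hq.2
  have key : ∀ y, eccMatrix Tᶜ u y * f y =
      (if y = v then 3 * f y else 0) + if T.Adj u y ∧ y ≠ v then 2 * f y else 0 := fun y => by
    by_cases hy : T.Adj u y
    · by_cases hyv : y = v
      · subst hyv
        simp [h.eccMatrix_center hc hp.1 hp.2 hq.1 hq.2]
      · rw [eccMatrix_comm, h.eccMatrix_leaf hc hy hyv hq.1 hq.2]
        simp [hy, hyv]
    · have hyv : y ≠ v := fun e => hy (e ▸ h.adj)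
      simp [eccMatrix_compl_of_not_adj hc h.exists_adj hy, hy, hyv]
  rw [Finset.sum_congr rfl fun y _ => key y, Finset.sum_add_distrib, Finset.mul_sum, leaves,
    Finset.sum_filter]
  simp

theorem sum_eccMatrix_leaf (h : IsDoubleStar T u v) (hx : x ∈ leaves T u v)
    (hv : (leaves T v u).Nonempty) (f : V → ℝ) :
    ∑ y, eccMatrix Tᶜ x y * f y = 2 * f u := by
  obtain ⟨q, hq⟩ := hv
  rw [mem_leaves] at hx hq
  have hc := h.compl_connected hx.1 hx.2 hq.1 hq.2
  rw [Finset.sum_eq_single u, h.eccMatrix_leaf hc hx.1 hx.2 hq.1 hq.2]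
  · intro y _ hy
    rw [eccMatrix_compl_of_not_adj hc h.exists_adj fun e => hy (h.eq_of_adj_leaf hx.1 hx.2 e),
      zero_mul]
  · simp

/-- The rows of the leaves give each leaf at a centre `c` the value `2 f(c) / μ`. Eliminating the
leaves leaves a 2×2 system in `f u`, `f v`, whose determinant condition is the stated equation. -/
theorem mem_eccEigenvalues_compl (h : IsDoubleStar T u v) (hu : (leaves T u v).Nonempty)
    (hv : (leaves T v u).Nonempty) {μ : ℝ} (hμ : μ ≠ 0) :
    μ ∈ eccEigenvalues Tᶜ ↔ (μ ^ 2 - 4 * (leaves T u v).card) * (μ ^ 2 - 4 * (leaves T v u).card)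
      = 9 * μ ^ 2 := by
  classical
  rw [mem_eccEigenvalues_iff]
  constructor
  · rintro ⟨f, hf, hM⟩
    have center : ∀ {u v}, IsDoubleStar T u v → (leaves T u v).Nonempty → (leaves T v u).Nonempty →
        (μ ^ 2 - 4 * (leaves T u v).card) * f u = 3 * μ * f v := fun {u v} h hu hv => by
      have h₁ := h.sum_eccMatrix_center hu hv f
      have h₂ : μ * ∑ y ∈ leaves T u v, f y = (leaves T u v).card * (2 * f u) := by
        rw [Finset.mul_sum, Finset.sum_congr rfl fun y hy =>
          (hM y).symm.trans (h.sum_eccMatrix_leaf hy hv f)]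
        simp
      rw [hM] at h₁
      linear_combination μ * h₁ + 2 * h₂
    have h₁ := center h hu hv
    have h₂ := center h.symm hv hu
    by_cases hfu : f u = 0
    · exfalso
      have hfv : f v = 0 := by simpa [hfu, hμ] using h₁
      refine hf (funext fun x => ?_)
      by_cases hxu : x = u
      · exact hxu ▸ hfu
      by_cases hxv : x = v
      · exact hxv ▸ hfv
      rcases h.dominating x hxu hxv with hx | hx
      · have := h.sum_eccMatrix_leaf (mem_leaves.mpr ⟨hx, hxv⟩) hv f
        simpa [hM, hfu, hμ] using this
      · have := h.symm.sum_eccMatrix_leaf (mem_leaves.mpr ⟨hx, hxu⟩) hu f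
        simpa [hM, hfv, hμ] using this
    · apply mul_right_cancel₀ hfu
      linear_combination (μ ^ 2 - 4 * (leaves T v u).card) * h₁ + 3 * μ * h₂
  · intro hdet
    set a : ℝ := μ ^ 2 - 4 * (leaves T u v).card with ha
    have huv := h.adj.ne
    -- `(3μ, a)` solves the equation at `u`; the leaves receive `2 · 3μ / μ = 6` and `2a / μ`.
    let f : V → ℝ := fun x =>
      if x = u then 3 * μ else if x = v then a else if T.Adj u x then 6 else 2 * a / μ
    have hfu : f u = 3 * μ := by simp [f]
    have hfv : f v = a := by simp [f, huv.symm]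
    have hfp : ∀ x ∈ leaves T u v, f x = 6 := fun x hx => by
      rw [mem_leaves] at hx
      simp [f, hx.1, hx.2, hx.1.ne']
    have hfq : ∀ x ∈ leaves T v u, f x = 2 * a / μ := fun x hx => by
      rw [mem_leaves] at hx
      have hux : ¬ T.Adj u x := fun e => h.not_adj_both x e hx.1
      simp [f, hux, hx.2, hx.1.ne']
    refine ⟨f, fun e => ?_, fun x => ?_⟩
    · simpa [hfu, hμ] using congrFun e u
    by_cases hxu : x = u
    · rw [hxu, h.sum_eccMatrix_center hu hv, Finset.sum_congr rfl hfp, hfu, hfv, ha]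
      simp
      ring
    by_cases hxv : x = v
    · rw [hxv, h.symm.sum_eccMatrix_center hv hu, Finset.sum_congr rfl hfq, hfu, hfv]
      simp
      field_simp
      linear_combination -hdet
    rcases h.dominating x hxu hxv with hx | hx
    · have hx : x ∈ leaves T u v := mem_leaves.mpr ⟨hx, hxv⟩
      rw [h.sum_eccMatrix_leaf hx hv, hfp x hx, hfu]
      ring
    · have hx : x ∈ leaves T v u := mem_leaves.mpr ⟨hx, hxu⟩
      rw [h.symm.sum_eccMatrix_leaf hx hu, hfq x hx, hfv]
      field_simp

end IsDoubleStar

/-- If the acyclic graph `T` has no dominating edge, then the eccentricity matrix of its complement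
is twice the adjacency matrix of `T`, and its eigenvalues obey the corresponding bound. -/
theorem sq_le_of_mem_eccEigenvalues_compl [Nontrivial V] (hT : T.IsTree) (hc : Tᶜ.Connected)
    (hdom : ∀ x y, T.Adj x y → ∃ z, ¬ T.Adj x z ∧ ¬ T.Adj z y) {μ : ℝ}
    (hμ : μ ∈ eccEigenvalues Tᶜ) : μ ^ 2 ≤ 4 * ((Fintype.card V : ℝ) - 1) := by
  classical
  obtain ⟨f, hf, hM⟩ := mem_eccEigenvalues_iff.mp hμ
  have hn : ∀ x, ∃ y, T.Adj x y := fun x => hT.1.preconnected.exists_adj_of_nontrivial x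
  have hrow : ∀ x, μ * f x = 2 * ∑ y ∈ T.neighborFinset x, f y := fun x => by
    rw [← hM x, neighborFinset_eq_filter, Finset.sum_filter, Finset.mul_sum]
    refine Finset.sum_congr rfl fun y _ => ?_
    by_cases hy : T.Adj x y
    · simp [hy, eccMatrix_compl_eq_two hc hy fun w hw => hdom x w hw]
    · simp [hy, eccMatrix_compl_of_not_adj hc hn hy]
  obtain ⟨C⟩ := hT.colorable_two
  have hcard : (T.edgeFinset.card : ℝ) = Fintype.card V - 1 := by
    rw [← hT.card_edgeFinset]
    push_cast
    ring
  have hC : ∀ i j : Fin 2, i ≠ j → T.IsBipartiteWith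
      ((Finset.univ.filter fun x => C x = i : Finset V) : Set V)
      ((Finset.univ.filter fun x => C x = j : Finset V) : Set V) := fun i j hij => by
    constructor
    · rw [Finset.disjoint_coe, Finset.disjoint_filter]
      rintro x - rfl e
      exact hij e
    · intro x y hxy
      have := C.valid hxy
      simp only [Finset.coe_filter, Finset.mem_univ, true_and, Set.mem_ofPred_eq]
      lia
  -- Cauchy–Schwarz at each vertex of colour `i`, whose neighbours all have colour `j`. Each edge
  -- has exactly one end of colour `i`, so the degrees there sum to `n - 1`.
  have part : ∀ i j : Fin 2, i ≠ j → μ ^ 2 * ∑ x with C x = i, f x ^ 2 ≤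
      4 * ((Fintype.card V : ℝ) - 1) * ∑ x with C x = j, f x ^ 2 := fun i j hij => by
    have hdeg : (Fintype.card V : ℝ) - 1 = ∑ x with C x = i, (T.degree x : ℝ) := by
      rw [← hcard, ← isBipartiteWith_sum_degrees_eq_card_edges (hC i j hij), Nat.cast_sum]
    rw [hdeg, Finset.mul_sum _ _ (μ ^ 2), mul_assoc, Finset.sum_mul, Finset.mul_sum _ _ (4 : ℝ)]
    refine Finset.sum_le_sum fun x hx => ?_
    have h₁ := sq_sum_le_card_mul_sum_sq (s := T.neighborFinset x) (f := f)
    have h₂ : ∑ y ∈ T.neighborFinset x, f y ^ 2 ≤ ∑ y with C y = j, f y ^ 2 :=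
      Finset.sum_le_sum_of_subset_of_nonneg
        (isBipartiteWith_neighborFinset_subset (hC i j hij) hx) fun y _ _ => sq_nonneg _
    rw [card_neighborFinset_eq_degree] at h₁
    calc μ ^ 2 * f x ^ 2 = 4 * (∑ y ∈ T.neighborFinset x, f y) ^ 2 := by
          rw [← mul_pow, hrow]
          ring
      _ ≤ 4 * (T.degree x * ∑ y with C y = j, f y ^ 2) := by gcongr; exact h₁.trans (by gcongr)
      _ = _ := by ring
  have hsum : ∑ x with C x = 0, f x ^ 2 + ∑ x with C x = 1, f x ^ 2 = ∑ x, f x ^ 2 := by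
    rw [← Finset.sum_fiberwise Finset.univ C fun x => f x ^ 2, Fin.sum_univ_two]
  have hpos : 0 < ∑ x, f x ^ 2 := by
    obtain ⟨x, hx⟩ := Function.ne_iff.mp hf
    exact Finset.sum_pos' (fun _ _ => sq_nonneg _) ⟨x, Finset.mem_univ _, sq_pos_of_ne_zero hx⟩
  refine le_of_mul_le_mul_right ?_ hpos
  rw [← hsum]
  linarith [part 0 1 (by decide), part 1 0 (by decide)]

end Spectrum

/-! ### Brooms and their uniqueness up to isomorphism. -/

/-- `T` consists of the pendant path `w u v` together with pendant vertices attached to `v`. -/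
structure IsBroom (T : SimpleGraph V) (w u v : V) : Prop where
  wu : w ≠ u
  wv : w ≠ v
  uv : u ≠ v
  adj_iff : ∀ x y, T.Adj x y ↔ (x = u ∧ y = w) ∨ (x = w ∧ y = u) ∨
    (x = v ∧ y ≠ v ∧ y ≠ w) ∨ (y = v ∧ x ≠ v ∧ x ≠ w)

namespace IsBroom

theorem isDoubleStar (h : IsBroom T w u v) : IsDoubleStar T u v := by
  obtain ⟨h₁, h₂, h₃, h⟩ := h
  constructor
  · grind
  · grind
  · grind
  · grind

theorem leaves_eq [Fintype V] (h : IsBroom T w u v) : leaves T u v = {w} := by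
  obtain ⟨h₁, h₂, h₃, h⟩ := h
  ext x
  rw [mem_leaves, h, Finset.mem_singleton]
  grind

theorem of_leaves_eq [Fintype V] (h : IsDoubleStar T u v) (hw : leaves T u v = {w}) :
    IsBroom T w u v := by
  have h₀ : ∀ x, (T.Adj u x ∧ x ≠ v) ↔ x = w := fun x => by
    rw [← mem_leaves, hw, Finset.mem_singleton]
  have hw' := (h₀ w).mpr rfl
  refine ⟨hw'.1.ne', hw'.2, h.adj.ne, fun x y => ?_⟩
  have key : ∀ y, T.Adj v y ↔ y ≠ v ∧ y ≠ w := fun y => by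
    refine ⟨fun e => ⟨e.ne', fun e' => h.not_adj_both w hw'.1 (e' ▸ e)⟩, fun ⟨hv, hw⟩ => ?_⟩
    by_cases hu : y = u
    · exact hu ▸ h.adj.symm
    · exact (h.dominating y hu hv).resolve_left fun e => hw ((h₀ y).mp ⟨e, hv⟩)
  have hu : ∀ y, T.Adj u y ↔ y = w ∨ y = v := fun y => by
    have := h₀ y
    have := h.adj
    grind
  have hedge := h.edge x y
  have := T.adj_comm x y
  have := h.adj.ne
  grind

theorem of_iso {V' : Type*} {T' : SimpleGraph V'} (e : T ≃g T') (h : IsBroom T w u v) :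
    IsBroom T' (e w) (e u) (e v) where
  wu := e.injective.ne h.wu
  wv := e.injective.ne h.wv
  uv := e.injective.ne h.uv
  adj_iff x y := by
    obtain ⟨x, rfl⟩ := e.surjective x
    obtain ⟨y, rfl⟩ := e.surjective y
    simp only [e.map_adj_iff, h.adj_iff, e.injective.eq_iff, ne_eq]

/-- Any bijection is corrected by three successive swaps, each fixing the images already placed. -/
theorem exists_equiv {V V' : Type*} [Fintype V] [Fintype V']
    (hcard : Fintype.card V = Fintype.card V') {w u v : V} {w' u' v' : V'}
    (h₁ : w ≠ u) (h₂ : w ≠ v) (h₃ : u ≠ v) (h₁' : w' ≠ u') (h₂' : w' ≠ v') (h₃' : u' ≠ v') :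
    ∃ e : V ≃ V', e w = w' ∧ e u = u' ∧ e v = v' := by
  classical
  let e₁ := (Fintype.equivOfCardEq hcard).trans (Equiv.swap (Fintype.equivOfCardEq hcard w) w')
  have hw₁ : e₁ w = w' := by simp [e₁]
  let e₂ := e₁.trans (Equiv.swap (e₁ u) u')
  have hu₂ : e₂ u = u' := by simp [e₂]
  have hw₂ : e₂ w = w' := by
    have : e₁ u ≠ w' := fun e => h₁ (e₁.injective (hw₁.trans e.symm))
    simp [e₂, hw₁, Equiv.swap_apply_of_ne_of_ne this.symm h₁']
  have hvu : e₂ v ≠ u' := fun e => h₃ (e₂.injective (hu₂.trans e.symm))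
  have hvw : e₂ v ≠ w' := fun e => h₂ (e₂.injective (hw₂.trans e.symm))
  refine ⟨e₂.trans (Equiv.swap (e₂ v) v'), ?_, ?_, ?_⟩
  · simp [hw₂, Equiv.swap_apply_of_ne_of_ne hvw.symm h₂']
  · simp [hu₂, Equiv.swap_apply_of_ne_of_ne hvu.symm h₃']
  · simp

theorem nonempty_iso {V' : Type*} [Fintype V] [Fintype V'] {T' : SimpleGraph V'} {w' u' v' : V'}
    (hcard : Fintype.card V = Fintype.card V') (h : IsBroom T w u v) (h' : IsBroom T' w' u' v') :
    Nonempty (T ≃g T') := by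
  obtain ⟨e, rfl, rfl, rfl⟩ := exists_equiv hcard h.wu h.wv h.uv h'.wu h'.wv h'.uv
  refine ⟨⟨e, fun {x y} => ?_⟩⟩
  simp only [h'.adj_iff, h.adj_iff, e.injective.eq_iff, ne_eq]

end IsBroom

theorem isBroom_doubleStar (k : ℕ) :
    IsBroom (doubleStar 0 k) (Sum.inl 0) (Sum.inl 1) (Sum.inl 2) where
  wu := by simp
  wv := by simp
  uv := by simp
  adj_iff x y := by
    rcases x with i | i | i
    · rcases y with j | j | j
      · fin_cases i <;> fin_cases j <;> simp [doubleStar]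
      · exact j.elim0
      · fin_cases i <;> simp [doubleStar]
    · exact i.elim0
    · rcases y with j | j | j
      · fin_cases j <;> simp [doubleStar]
      · exact j.elim0
      · simp [doubleStar]

/-! ### The larger root of `s² - (4n + 1)s + 16(n - 3)`. -/

/-- The square of the least eccentricity eigenvalue of the complement of the broom of order `n`. -/
noncomputable def broomRadiusSq (n : ℝ) : ℝ :=
  (4 * n + 1 + √((4 * n + 1) ^ 2 - 64 * (n - 3))) / 2

theorem broomRadiusSq_root (n : ℝ) :
    broomRadiusSq n ^ 2 - (4 * n + 1) * broomRadiusSq n + 16 * (n - 3) = 0 := by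
  have := Real.sq_sqrt (show 0 ≤ (4 * n + 1) ^ 2 - 64 * (n - 3) by nlinarith [sq_nonneg (n - 2)])
  unfold broomRadiusSq
  linear_combination this / 4

theorem le_two_mul_broomRadiusSq (n : ℝ) : 4 * n + 1 ≤ 2 * broomRadiusSq n := by
  unfold broomRadiusSq
  linarith [Real.sqrt_nonneg ((4 * n + 1) ^ 2 - 64 * (n - 3))]

theorem lt_broomRadiusSq {n s : ℝ} (h : s ^ 2 - (4 * n + 1) * s + 16 * (n - 3) < 0) :
    s < broomRadiusSq n := by
  by_contra! hs
  nlinarith [broomRadiusSq_root n, le_two_mul_broomRadiusSq n,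
    mul_nonneg (sub_nonneg.mpr hs) (by linarith [le_two_mul_broomRadiusSq n] :
      0 ≤ s + broomRadiusSq n - (4 * n + 1))]

/-! ### Comparison with the broom. -/

section Main

variable [Fintype V]

theorem IsDoubleStar.sq_le_broomRadiusSq (h : IsDoubleStar T u v) (hu : (leaves T u v).Nonempty)
    (hv : (leaves T v u).Nonempty) {μ : ℝ} (hμ : μ ∈ eccEigenvalues Tᶜ) :
    μ ^ 2 ≤ broomRadiusSq (Fintype.card V) ∧ (μ ^ 2 = broomRadiusSq (Fintype.card V) →
      (leaves T u v).card = 1 ∨ (leaves T v u).card = 1) := by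
  have hcard : ((leaves T u v).card : ℝ) + (leaves T v u).card + 2 = Fintype.card V := by
    exact_mod_cast h.card_leaves_add
  have hp : (1 : ℝ) ≤ (leaves T u v).card := by exact_mod_cast hu.card_pos
  have hq : (1 : ℝ) ≤ (leaves T v u).card := by exact_mod_cast hv.card_pos
  have hroot := broomRadiusSq_root (Fintype.card V)
  have hle := le_two_mul_broomRadiusSq (Fintype.card V)
  -- The characteristic equation is only available for `μ ≠ 0`; zero is harmless because
  -- `broomRadiusSq` is positive.
  rcases eq_or_ne μ 0 with rfl | hμ₀
  · constructor
    · norm_num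
      linarith
    · intro e
      norm_num at e
      linarith
  have heq := (h.mem_eccEigenvalues_compl hu hv hμ₀).mp hμ
  -- The broom's quadratic at `μ²` equals `-16(p - 1)(q - 1) ≤ 0`, vanishing only if a centre has a
  -- single leaf.
  have key : (μ ^ 2) ^ 2 - (4 * (Fintype.card V : ℝ) + 1) * μ ^ 2 +
      16 * ((Fintype.card V : ℝ) - 3) =
        -16 * (((leaves T u v).card - 1 : ℝ) * ((leaves T v u).card - 1)) := by
    rw [← hcard]
    linear_combination heq
  constructor
  · have h₀ := mul_nonneg (sub_nonneg.mpr hp) (sub_nonneg.mpr hq)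
    by_contra! hs
    nlinarith
  · intro e
    rw [e, hroot] at key
    have : ((leaves T u v).card - 1 : ℝ) * ((leaves T v u).card - 1) = 0 := by linarith
    rcases mul_eq_zero.mp this with e | e
    · exact Or.inl (by exact_mod_cast sub_eq_zero.mp e)
    · exact Or.inr (by exact_mod_cast sub_eq_zero.mp e)

theorem leastEccEigenvalue_mem [Nonempty V] (G : SimpleGraph V) :
    leastEccEigenvalue G ∈ eccEigenvalues G :=
  (isLeast_leastEccEigenvalue G).1

theorem IsBroom.leastEccEigenvalue_compl (h : IsBroom T w u v) (hn : 4 ≤ Fintype.card V) :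
    leastEccEigenvalue Tᶜ = -√(broomRadiusSq (Fintype.card V)) := by
  have : Nonempty V := ⟨u⟩
  have hds := h.isDoubleStar
  have hu : (leaves T u v).Nonempty := by simp [h.leaves_eq]
  have hcard := hds.card_leaves_add
  rw [h.leaves_eq, Finset.card_singleton] at hcard
  have hv : (leaves T v u).Nonempty := Finset.card_pos.mp (by omega)
  have hpos : 0 < broomRadiusSq (Fintype.card V) := by
    have := le_two_mul_broomRadiusSq (Fintype.card V)
    have : (0 : ℝ) ≤ Fintype.card V := Nat.cast_nonneg _
    linarith
  apply le_antisymm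
  · apply (isLeast_leastEccEigenvalue Tᶜ).2
    rw [hds.mem_eccEigenvalues_compl hu hv (by simpa using (Real.sqrt_pos.mpr hpos).ne'),
      neg_sq, Real.sq_sqrt hpos.le, h.leaves_eq, Finset.card_singleton]
    have hcard' : (1 : ℝ) + (leaves T v u).card + 2 = Fintype.card V := by exact_mod_cast hcard
    have hroot := broomRadiusSq_root (Fintype.card V)
    push_cast
    linear_combination hroot - (4 * broomRadiusSq (Fintype.card V) - 16) * hcard'
  · exact Real.neg_sqrt_le_of_sq_le
      (hds.sq_le_broomRadiusSq hu hv (leastEccEigenvalue_mem Tᶜ)).1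

/-- A neighbour of `u` in the complement must, by domination, be a leaf at `v`; this is where stars
are excluded. -/
theorem IsDoubleStar.leaves_nonempty [Nontrivial V] (h : IsDoubleStar T u v)
    (hc : Tᶜ.Connected) : (leaves T v u).Nonempty := by
  obtain ⟨q, hq⟩ := hc.preconnected.exists_adj_of_nontrivial u
  rw [compl_adj] at hq
  exact ⟨q, mem_leaves.mpr ⟨(h.dominating q hq.1.symm fun e => hq.2 (e ▸ h.adj)).resolve_left hq.2,
    hq.1.symm⟩⟩

/-- Among trees with connected complement, the square of an eccentricity eigenvalue of the
complement is at most that attained by the broom, which is the only extremal tree. -/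
theorem sq_le_broomRadiusSq [Nontrivial V] (hT : T.IsTree) (hc : Tᶜ.Connected) {μ : ℝ}
    (hμ : μ ∈ eccEigenvalues Tᶜ) :
    μ ^ 2 ≤ broomRadiusSq (Fintype.card V) ∧ (μ ^ 2 = broomRadiusSq (Fintype.card V) →
      ∃ w u v, IsBroom T w u v) := by
  by_cases hdom : ∀ x y, T.Adj x y → ∃ z, ¬ T.Adj x z ∧ ¬ T.Adj z y
  · have h₁ := sq_le_of_mem_eccEigenvalues_compl hT hc hdom hμ
    -- At `s = 4(n - 1)` the quadratic equals `-4n - 28 < 0`; strictness rules out equality in this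
    -- case.
    have h₂ : 4 * ((Fintype.card V : ℝ) - 1) < broomRadiusSq (Fintype.card V) := by
      have : (0 : ℝ) ≤ Fintype.card V := Nat.cast_nonneg _
      apply lt_broomRadiusSq
      nlinarith
    exact ⟨h₁.trans h₂.le, fun e => absurd (h₁.trans_lt h₂) e.not_lt⟩
  · push Not at hdom
    obtain ⟨u, v, huv, hdom⟩ := hdom
    have h := isDoubleStar_of_isAcyclic hT.isAcyclic huv fun x _ _ =>
      or_iff_not_imp_left.mpr fun e => (hdom x e).symm
    obtain ⟨h₁, h₂⟩ := h.sq_le_broomRadiusSq (h.symm.leaves_nonempty hc) (h.leaves_nonempty hc) hμ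
    refine ⟨h₁, fun e => ?_⟩
    rcases h₂ e with e | e
    · obtain ⟨w, hw⟩ := Finset.card_eq_one.mp e
      exact ⟨w, u, v, .of_leaves_eq h hw⟩
    · obtain ⟨w, hw⟩ := Finset.card_eq_one.mp e
      exact ⟨w, v, u, .of_leaves_eq h.symm hw⟩

end Main

end EccComplTree

theorem mainTheorem4 {V : Type*} [Fintype V] (n : ℕ) (hn : 4 ≤ n)
    (hcard : Fintype.card V = n) (T : SimpleGraph V) (hT : T.IsTree) (hTc : Tᶜ.Connected) :
    EccComplTree.leastEccEigenvalue Tᶜ ≥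
        EccComplTree.leastEccEigenvalue (EccComplTree.doubleStar 0 (n - 4))ᶜ ∧
      (EccComplTree.leastEccEigenvalue Tᶜ =
          EccComplTree.leastEccEigenvalue (EccComplTree.doubleStar 0 (n - 4))ᶜ ↔
        Nonempty (T ≃g EccComplTree.doubleStar 0 (n - 4))) := by
  have : Nontrivial V := Fintype.one_lt_card_iff_nontrivial.mp (by omega)
  have hB := EccComplTree.isBroom_doubleStar (n - 4)
  have hcard' : Fintype.card (Fin 4 ⊕ (Fin 0 ⊕ Fin (n - 4))) = n := by simp; omega
  rw [hB.leastEccEigenvalue_compl (by omega), hcard']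
  obtain ⟨h₁, h₂⟩ := EccComplTree.sq_le_broomRadiusSq hT hTc (EccComplTree.leastEccEigenvalue_mem Tᶜ)
  rw [hcard] at h₁ h₂
  refine ⟨Real.neg_sqrt_le_of_sq_le h₁, fun e => ?_, fun ⟨e⟩ => ?_⟩
  · have hpos : 0 ≤ EccComplTree.broomRadiusSq n := (sq_nonneg _).trans h₁
    obtain ⟨w, u, v, h⟩ := h₂ (by rw [e, neg_sq, Real.sq_sqrt hpos])
    exact h.nonempty_iso (by rw [hcard, hcard']) hB
  · rw [(hB.of_iso e.symm).leastEccEigenvalue_compl (by omega), hcard]
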